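/- Let $d_{\mathrm{in}}, d_{\mathrm{out}}, m$ be natural numbers, let $|\psi\rangle=\sum_x \mu_x|x\rangle\in\mathbb{C}^{d_{\mathrm{in}}}$ be a unit vector, let $p_1,\dots,p_m\ge 0$ with $\sum_j p_j=1$, and let $|\phi_j\rangle=\sum_y \nu^j_y|y\rangle\in\mathbb{C}^{d_{\mathrm{out}}}$ ($1\le j\le m$) be unit vectors. Write $\psi=|\psi\rangle\langle\psi|$ and $\phi_j=|\phi_j\rangle\langle\phi_j|$. The standard bases $\{|x\rangle\}$ of $\mathbb{C}^{d_{\mathrm{in}}}$ and $\{|j\rangle\otimes|y\rangle\}$ of $\mathbb{C}^m\otimes\mathbb{C}^{d_{\mathrm{out}}}$ are the incoherent bases, and $\Delta(\cdot)=\sum_i |i\rangle\langle i|\cdot|i\rangle\langle i|$ denotes the completely dephasing channel in the respective incoherent basis. A dephasing-covariant incoherent operation (DIO) is a completely positive trace-preserving linear map $\mathcal{E}$ with $\Delta\circ\mathcal{E}=\mathcal{E}\circ\Delta$. For a real vector $v$, let $v^{\downarrow}$ be the vector of its components in non-increasing order. For vectors $u,v$ with nonnegative entries, write $u\prec v$ if,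 after the shorter vector is extended by zeros to the length of the longer one, $\sum_{i\le k}u^{\downarrow}_i\le\sum_{i\le k}v^{\downarrow}_i$ for every $k$, and $\sum_i u_i=\sum_i v_i$. Let $q=(|\mu_x|^2)_x$ and $q_j=(|\nu^j_y|^2)_y$, i.e. the diagonals of $\Delta(\psi)$ and $\Delta(\phi_j)$. Then there exists a DIO $\mathcal{E}$ from operators on $\mathbb{C}^{d_{\mathrm{in}}}$ to operators on $\mathbb{C}^m\otimes\mathbb{C}^{d_{\mathrm{out}}}$ such that $$\mathcal{E}(\psi)=\sum_{j=1}^m p_j\,|j\rangle\langle j|\otimes\phi_j$$ if and only if $$q\prec\sum_{j=1}^m p_j\,q_j^{\downarrow}.$$ -/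

import Mathlib

open scoped Matrix ComplexOrder MatrixOrder Matrix.Norms.L2Operator CStarAlgebra Kronecker

noncomputable section

/-- The rank-one projector `|ψ⟩⟨ψ|` of a vector, as a matrix in the incoherent basis. -/
def pureState {d : ℕ} (ψ : EuclideanSpace ℂ (Fin d)) : Matrix (Fin d) (Fin d) ℂ :=
  Matrix.vecMulVec ψ.ofLp (star ψ.ofLp)

/-- The completely dephasing channel `Δ(M) = ∑ i, |i⟩⟨i| M |i⟩⟨i|` in the standard basis. For a
product index type this is dephasing in the product basis. -/
def dephase {ι : Type*} [DecidableEq ι] (M : Matrix ι ι ℂ) : Matrix ι ι ℂ :=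
  Matrix.diagonal M.diag

/-- A dephasing-covariant incoherent operation: a quantum channel (completely positive and
trace-preserving linear map) that commutes with dephasing. -/
structure IsDIO {ι κ : Type*} [Fintype ι] [DecidableEq ι] [Fintype κ] [DecidableEq κ]
    (E : Matrix ι ι ℂ →CP Matrix κ κ ℂ) : Prop where
  trace_preserving : ∀ M, (E M).trace = M.trace
  dephasing_covariant : ∀ M, dephase (E M) = E (dephase M)

/-- The incoherent distribution `Δ(ψ)`: the diagonal `(|ψ₁|², …, |ψ_d|²)` of the dephased state. -/
def cohDist {d : ℕ} (ψ : EuclideanSpace ℂ (Fin d)) : Fin d → ℝ :=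
  fun x => ‖ψ x‖ ^ 2

/-- The heralded ensemble state `∑ j, p j |j⟩⟨j| ⊗ |φ j⟩⟨φ j|`. -/
def heraldedState {m d : ℕ} (p : Fin m → ℝ) (φ : Fin m → EuclideanSpace ℂ (Fin d)) :
    Matrix (Fin m × Fin d) (Fin m × Fin d) ℂ :=
  ∑ j, (p j : ℂ) • (Matrix.single j j (1 : ℂ) ⊗ₖ pureState (φ j))

/-- `v↓`: the components of `v` in non-increasing order. -/
def decreasing {n : ℕ} (v : Fin n → ℝ) : Fin n → ℝ :=
  v ∘ Tuple.sort (fun i => -v i)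

theorem decreasing_antitone {n : ℕ} (v : Fin n → ℝ) : Antitone (decreasing v) := fun _ _ h =>
  neg_le_neg_iff.mp (Tuple.monotone_sort (fun i => -v i) h)

/-- Extend a vector to length `N` by trailing zeros (used for `n ≤ N`). -/
def padZeros {n : ℕ} (N : ℕ) (v : Fin n → ℝ) : Fin N → ℝ :=
  fun i => if h : i.val < n then v ⟨i.val, h⟩ else 0

/-- Majorization `u ≺ v`; the shorter vector is first extended by zeros to the length of
the longer one. -/
def Majorized {m n : ℕ} (u : Fin m → ℝ) (v : Fin n → ℝ) : Prop :=
  (∀ k ≤ max m n,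
    ∑ i : Fin (max m n) with i.val < k, decreasing (padZeros (max m n) u) i ≤
      ∑ i : Fin (max m n) with i.val < k, decreasing (padZeros (max m n) v) i) ∧
  ∑ i, u i = ∑ i, v i

end

/-!
Necessity: let `z x a` be the Gram vectors of the Choi matrix of `E`, scaled by the amplitudes of
`ψ`. Covariance under dephasing makes them orthogonal in `x` and in `a`, while the sums
`∑ x, z x (j, y)` have the rank-one Gram matrix `p j • |φ j⟩⟨φ j|` within each herald block `j`, so
they are multiples `star (φ j y) • c` of a single vector with `‖c‖ ^ 2 ≤ p j`. For each `x`,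
Bessel's inequality for `c` bounds the sum over `y` of the weights `‖z x (j, y)‖ ^ 2 / |φ j y| ^ 2`
by `p j`, so no `k` of the `x` can carry more than the `k` largest entries of `p j • cohDist (φ j)`
out of block `j`.

Sufficiency: by Hahn-Banach separation and the rearrangement inequality, a majorized vector is a
convex mixture of permutations of the majorizing one. Each permutation in the mixture, together with
a herald `j`, gives a Kraus operator matching basis vectors of the input with those of the output.
-/

/-! ### Majorization -/

/-- The sum of the `k` largest entries of `v` (the Ky Fan `k`-sum); for `k ≥ n` it is the sum of all
entries. -/
noncomputable def topSum {n : ℕ} (k : ℕ) (v : Fin n → ℝ) : ℝ :=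
  ∑ i : Fin n with i.val < k, decreasing v i

theorem sum_decreasing {n : ℕ} (v : Fin n → ℝ) : ∑ i, decreasing v i = ∑ i, v i :=
  Equiv.sum_comp (Tuple.sort fun i => -v i) v

theorem decreasing_eq_self {n : ℕ} {v : Fin n → ℝ} (hv : Antitone v) : decreasing v = v := by
  have hsort : Tuple.sort (fun i => -v i) = Equiv.refl _ :=
    Tuple.sort_eq_refl_iff_monotone.2 hv.neg
  simp only [decreasing, hsort, Equiv.coe_refl, Function.comp_id]

theorem sum_ite_val_lt_le {n : ℕ} (k : ℕ) :
    ∑ i : Fin n, (if i.val < k then (1 : ℝ) else 0) ≤ k := by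
  rw [Finset.sum_boole, Fin.card_filter_val_lt]
  exact_mod_cast min_le_right n k

theorem dotProduct_le_topSum {n k : ℕ} {a v : Fin n → ℝ} (ha : a ∈ Set.Icc 0 1)
    (hak : ∑ i, a i ≤ k) (hv : 0 ≤ v) : a ⬝ᵥ v ≤ topSum k v := by
  let e := Tuple.sort fun i => -v i
  have hsum : a ⬝ᵥ v = ∑ i, a (e i) * decreasing v i :=
    (Equiv.sum_comp e fun i => a i * v i).symm
  rw [hsum, topSum, Finset.sum_filter]
  rcases le_or_gt n k with hnk | hkn
  · refine Finset.sum_le_sum fun i _ => ?_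
    rw [if_pos (i.2.trans_le hnk)]
    exact mul_le_of_le_one_left (hv _) (ha.2 _)
  set τ := decreasing v ⟨k, hkn⟩
  -- Moving weight across the threshold `τ` can only lose value.
  have hexchange (i : Fin n) :
      a (e i) * decreasing v i - (if i.val < k then decreasing v i else 0) ≤
        (a (e i) - if i.val < k then 1 else 0) * τ := by
    split_ifs with hik
    · have : τ ≤ decreasing v i := decreasing_antitone v (Fin.mk_le_mk.2 hik.le : i ≤ ⟨k, hkn⟩)
      nlinarith [ha.2 (e i), Pi.one_apply (M := fun _ => ℝ) (e i)]
    · have : decreasing v i ≤ τ :=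
        decreasing_antitone v (Fin.mk_le_mk.2 (not_lt.1 hik) : (⟨k, hkn⟩ : Fin n) ≤ i)
      nlinarith [ha.1 (e i), Pi.zero_apply (M := fun _ => ℝ) (e i)]
  have hweight : ∑ i : Fin n, (a (e i) - if i.val < k then (1 : ℝ) else 0) ≤ 0 := by
    rw [Finset.sum_sub_distrib, Equiv.sum_comp e a, Finset.sum_boole, Fin.card_filter_val_lt,
      min_eq_right hkn.le]
    exact sub_nonpos.2 hak
  rw [← sub_nonpos, ← Finset.sum_sub_distrib]
  calc _ ≤ ∑ i : Fin n, (a (e i) - if i.val < k then 1 else 0) * τ :=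
        Finset.sum_le_sum fun i _ => hexchange i
    _ = (∑ i : Fin n, (a (e i) - if i.val < k then 1 else 0)) * τ := (Finset.sum_mul ..).symm
    _ ≤ 0 := mul_nonpos_of_nonpos_of_nonneg hweight (hv _)

theorem exists_dotProduct_eq_topSum {n : ℕ} (k : ℕ) (v : Fin n → ℝ) :
    ∃ a ∈ Set.Icc (0 : Fin n → ℝ) 1, ∑ i, a i ≤ k ∧ a ⬝ᵥ v = topSum k v := by
  let e := Tuple.sort fun i => -v i
  let b : Fin n → ℝ := fun i => if i.val < k then 1 else 0
  have hb (i) : 0 ≤ b i ∧ b i ≤ 1 := by dsimp only [b]; split_ifs <;> norm_num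
  refine ⟨b ∘ e.symm, ⟨fun i => (hb _).1, fun i => (hb _).2⟩, ?_, ?_⟩
  · exact (Equiv.sum_comp e.symm b).trans_le (sum_ite_val_lt_le k)
  · calc b ∘ e.symm ⬝ᵥ v = ∑ i, b i * decreasing v i := by
          rw [dotProduct, ← Equiv.sum_comp e]
          simp [decreasing, e]
      _ = topSum k v := by simp [b, topSum, Finset.sum_filter]

theorem topSum_sum_smul_decreasing {J : Type*} [Fintype J] {n : ℕ} (k : ℕ) {p : J → ℝ}
    (hp : 0 ≤ p) (v : J → Fin n → ℝ) :
    topSum k (∑ j, p j • decreasing (v j)) = ∑ j, p j * topSum k (v j) := by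
  have hanti : Antitone (∑ j, p j • decreasing (v j)) := fun i i' h => by
    simp only [Finset.sum_apply, Pi.smul_apply, smul_eq_mul]
    exact Finset.sum_le_sum fun j _ =>
      mul_le_mul_of_nonneg_left (decreasing_antitone (v j) h) (hp j)
  simp only [topSum, decreasing_eq_self hanti, Finset.sum_apply, Pi.smul_apply, smul_eq_mul,
    Finset.mul_sum]
  exact Finset.sum_comm

section PadZeros

variable {n N : ℕ}

theorem padZeros_apply_eq_sum (h : n ≤ N) (v : Fin n → ℝ) (i : Fin N) :
    padZeros N v i = ∑ l, if i = Fin.castLE h l then v l else 0 := by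
  by_cases hi : i.val < n
  · rw [Finset.sum_eq_single ⟨i, hi⟩]
    · simp [padZeros, hi]
    · rintro l - hl
      exact if_neg fun hil => hl (by ext; simp [hil])
    · simp
  · rw [padZeros, dif_neg hi]
    refine (Finset.sum_eq_zero fun l _ => if_neg ?_).symm
    rintro rfl
    exact hi l.2

theorem padZeros_castLE (h : n ≤ N) (v : Fin n → ℝ) (l : Fin n) :
    padZeros N v (Fin.castLE h l) = v l := by
  simp [padZeros]

theorem padZeros_mono {v w : Fin n → ℝ} (hvw : v ≤ w) : padZeros N v ≤ padZeros N w := by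
  intro i
  unfold padZeros
  split_ifs
  exacts [hvw _, le_rfl]

theorem padZeros_nonneg {v : Fin n → ℝ} (hv : 0 ≤ v) : 0 ≤ padZeros N v := by
  simpa [padZeros, Pi.le_def] using padZeros_mono (N := N) hv

theorem dotProduct_padZeros (h : n ≤ N) (a : Fin N → ℝ) (v : Fin n → ℝ) :
    a ⬝ᵥ padZeros N v = (a ∘ Fin.castLE h) ⬝ᵥ v := by
  simp only [dotProduct, padZeros_apply_eq_sum h, Finset.mul_sum, mul_ite, mul_zero]
  rw [Finset.sum_comm]
  simp

theorem sum_padZeros (h : n ≤ N) (v : Fin n → ℝ) : ∑ i, padZeros N v i = ∑ l, v l := by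
  simpa [dotProduct] using dotProduct_padZeros h 1 v

theorem topSum_padZeros (h : n ≤ N) (k : ℕ) {v : Fin n → ℝ} (hv : 0 ≤ v) :
    topSum k (padZeros N v) = topSum k v := by
  refine le_antisymm ?_ ?_
  · obtain ⟨a, ha, hak, hav⟩ := exists_dotProduct_eq_topSum k (padZeros N v)
    rw [← hav, dotProduct_padZeros h]
    refine dotProduct_le_topSum ⟨fun l => ha.1 _, fun l => ha.2 _⟩ (le_trans ?_ hak) hv
    calc ∑ l, a (Fin.castLE h l) = ∑ i ∈ Finset.univ.map (Fin.castLEEmb h), a i :=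
          (Finset.sum_map Finset.univ (Fin.castLEEmb h) a).symm
      _ ≤ ∑ i, a i := Finset.sum_le_univ_sum_of_nonneg ha.1
  · obtain ⟨a, ha, hak, hav⟩ := exists_dotProduct_eq_topSum k v
    have hpad : padZeros N a ⬝ᵥ padZeros N v = a ⬝ᵥ v := by
      rw [dotProduct_padZeros h, show padZeros N a ∘ Fin.castLE h = a from
        funext (padZeros_castLE h a)]
    rw [← hav, ← hpad]
    refine dotProduct_le_topSum ⟨padZeros_nonneg ha.1, fun i => ?_⟩
      ((sum_padZeros h a).trans_le hak) (padZeros_nonneg hv)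
    refine (padZeros_mono ha.2 i).trans ?_
    unfold padZeros
    split_ifs <;> simp

end PadZeros

theorem majorized_of_topSum_le {m n : ℕ} {u : Fin m → ℝ} {v : Fin n → ℝ} (hu : 0 ≤ u)
    (hv : 0 ≤ v) (h : ∀ k, topSum k u ≤ topSum k v) (hsum : ∑ i, u i = ∑ i, v i) :
    Majorized u v :=
  ⟨fun k _ => ((topSum_padZeros (le_max_left m n) k hu).trans_le (h k)).trans_eq
    (topSum_padZeros (le_max_right m n) k hv).symm, hsum⟩

theorem sum_mul_nonneg_of_antitone {n : ℕ} {c d : Fin n → ℝ} (hc : Antitone c) (hc0 : 0 ≤ c)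
    (hd : ∀ k ≤ n, 0 ≤ ∑ i : Fin n with i.val < k, d i) : 0 ≤ ∑ i, c i * d i := by
  induction n with
  | zero => simp
  | succ n ih =>
    have hcd : ∑ i, c i * d i = ∑ i : Fin n, (c i.castSucc - c (Fin.last n)) * d i.castSucc +
        c (Fin.last n) * ∑ i, d i := by
      simp only [Fin.sum_univ_castSucc, sub_mul, Finset.sum_sub_distrib, mul_add, Finset.mul_sum]
      ring
    have htail : 0 ≤ ∑ i : Fin n, (c i.castSucc - c (Fin.last n)) * d i.castSucc := by
      refine ih (fun i j hij => sub_le_sub_right (hc (Fin.castSucc_le_castSucc_iff.2 hij)) _)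
        (fun i => sub_nonneg.2 (hc (Fin.le_last _))) fun k hk => ?_
      simpa [Finset.sum_filter, Fin.sum_univ_castSucc, hk.not_gt] using hd k (hk.trans n.le_succ)
    have hall : 0 ≤ ∑ i, d i := by
      simpa only [Fin.is_lt, Finset.filter_true] using hd (n + 1) le_rfl
    rw [hcd]
    exact add_nonneg htail (mul_nonneg (hc0 _) hall)

section Rado

variable {n : ℕ}

theorem dotProduct_le_dotProduct_decreasing (c v : Fin n → ℝ) :
    c ⬝ᵥ v ≤ decreasing c ⬝ᵥ decreasing v := by
  have hmono : Monovary (decreasing c) (decreasing v) :=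
    (decreasing_antitone c).monovary (decreasing_antitone v)
  let e := Tuple.sort fun i => -c i
  let f := Tuple.sort fun i => -v i
  calc c ⬝ᵥ v = ∑ i, c (e i) * v (e i) := (Equiv.sum_comp e fun i => c i * v i).symm
    _ = ∑ i, decreasing c i * decreasing v ((e.trans f.symm) i) := by simp [decreasing, e, f]
    _ ≤ decreasing c ⬝ᵥ decreasing v := hmono.sum_mul_comp_perm_le_sum_mul

theorem exists_perm_dotProduct_comp_eq (c v : Fin n → ℝ) :
    ∃ e : Equiv.Perm (Fin n), c ⬝ᵥ v ∘ e = decreasing c ⬝ᵥ decreasing v := by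
  let e := Tuple.sort fun i => -c i
  refine ⟨e.symm.trans (Tuple.sort fun i => -v i), ?_⟩
  rw [dotProduct, ← Equiv.sum_comp e]
  simp [dotProduct, decreasing, e]

theorem dotProduct_decreasing_le_of_topSum_le {c u v : Fin n → ℝ}
    (h : ∀ k ≤ n, topSum k u ≤ topSum k v) (hsum : ∑ i, u i = ∑ i, v i) :
    decreasing c ⬝ᵥ decreasing u ≤ decreasing c ⬝ᵥ decreasing v := by
  obtain ⟨b, hb⟩ := (Set.finite_range (decreasing c)).bddBelow
  have hshift : 0 ≤ ∑ i, (decreasing c i - b) * (decreasing v i - decreasing u i) := by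
    refine sum_mul_nonneg_of_antitone
      (fun i j hij => sub_le_sub_right (decreasing_antitone c hij) b)
      (fun i => sub_nonneg.2 (hb ⟨i, rfl⟩)) fun k hk => ?_
    rw [Finset.sum_sub_distrib]
    exact sub_nonneg.2 (h k hk)
  have htotal : ∑ i, (decreasing v i - decreasing u i) = 0 := by
    rw [Finset.sum_sub_distrib, sum_decreasing, sum_decreasing, hsum, sub_self]
  have hsub : ∑ i, (decreasing c i - b) * (decreasing v i - decreasing u i) =
      decreasing c ⬝ᵥ decreasing v - decreasing c ⬝ᵥ decreasing u := by
    simp only [sub_mul, Finset.sum_sub_distrib, ← Finset.mul_sum, htotal, mul_zero, sub_zero]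
    simp only [dotProduct, mul_sub, Finset.sum_sub_distrib]
  exact sub_nonneg.1 (hsub ▸ hshift)

/- Otherwise a linear functional separates `u` from the mixtures of permutations of `v`; by the
rearrangement inequality its value at some permutation of `v` is at least its value at `u`. -/
theorem exists_perm_mixture_of_topSum_le {u v : Fin n → ℝ}
    (h : ∀ k ≤ n, topSum k u ≤ topSum k v) (hsum : ∑ i, u i = ∑ i, v i) :
    ∃ t ∈ stdSimplex ℝ (Equiv.Perm (Fin n)), ∑ e, t e • v ∘ e = u := by
  let L := Fintype.linearCombination ℝ fun e : Equiv.Perm (Fin n) => v ∘ e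
  by_contra hu
  obtain ⟨f, b, hf, hb⟩ := geometric_hahn_banach_closed_point
    ((convex_stdSimplex ℝ _).linear_image L)
    ((isCompact_stdSimplex ℝ _).image L.continuous_of_finiteDimensional).isClosed hu
  let c : Fin n → ℝ := fun i => f fun j => if i = j then 1 else 0
  have hfc (w : Fin n → ℝ) : f w = c ⬝ᵥ w :=
    (LinearMap.pi_apply_eq_sum_univ (f : (Fin n → ℝ) →ₗ[ℝ] ℝ) w).trans
      (Finset.sum_congr rfl fun _ _ => mul_comm _ _)
  obtain ⟨e, he⟩ := exists_perm_dotProduct_comp_eq c v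
  have hL : L (Pi.single e 1) = v ∘ e := by
    rw [Fintype.linearCombination_apply_single, one_smul]
  have hperm : c ⬝ᵥ v ∘ e < b := by
    rw [← hfc, ← hL]
    exact hf _ ⟨_, single_mem_stdSimplex ℝ e, rfl⟩
  have huv : c ⬝ᵥ u ≤ c ⬝ᵥ v ∘ e := calc
    c ⬝ᵥ u ≤ decreasing c ⬝ᵥ decreasing u := dotProduct_le_dotProduct_decreasing c u
    _ ≤ decreasing c ⬝ᵥ decreasing v := dotProduct_decreasing_le_of_topSum_le h hsum
    _ = c ⬝ᵥ v ∘ e := he.symm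
  exact absurd (hfc u ▸ hb) (huv.trans_lt hperm).not_gt

end Rado

theorem exists_perm_mixture_of_majorized {m n : ℕ} {u : Fin m → ℝ} {v : Fin n → ℝ}
    (h : Majorized u v) :
    ∃ t ∈ stdSimplex ℝ (Equiv.Perm (Fin (max m n))),
      ∑ e, t e • padZeros (max m n) v ∘ e = padZeros (max m n) u :=
  exists_perm_mixture_of_topSum_le h.1 <| by
    rw [sum_padZeros (le_max_left m n), sum_padZeros (le_max_right m n), h.2]

/-! ### Choi matrices and Kraus operators -/

section CompletelyPositive

variable {n κ : Type*} [Fintype n] [DecidableEq n] [Fintype κ] [DecidableEq κ]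

/-- Reading a matrix of matrices as a single matrix indexed by pairs. It identifies the C⋆-order on
block matrices, which defines complete positivity, with positive semidefiniteness. -/
def cstarMatrixCompEquiv (k n : Type*) [Fintype k] [Fintype n] [DecidableEq n] :
    CStarMatrix k k (Matrix n n ℂ) ≃⋆+* Matrix (k × n) (k × n) ℂ where
  __ := CStarMatrix.ofMatrixRingEquiv.symm.trans (Matrix.compRingEquiv k n ℂ)
  map_star' _ := rfl

theorem cstarMatrixCompEquiv_apply {k : Type*} [Fintype k]
    (M : CStarMatrix k k (Matrix n n ℂ)) (a b : k × n) :
    cstarMatrixCompEquiv k n M a b = M a.1 b.1 a.2 b.2 := rfl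

theorem posSemidef_cstarMatrixCompEquiv_iff {k : Type*} [Fintype k]
    {M : CStarMatrix k k (Matrix n n ℂ)} :
    (cstarMatrixCompEquiv k n M).PosSemidef ↔ 0 ≤ M := by
  classical
  rw [← Matrix.nonneg_iff_posSemidef, ← map_zero (cstarMatrixCompEquiv k n), map_le_map_iff]

/-- The completely positive map with given Kraus operators. -/
def krausMap {ι : Type*} [Fintype ι] (K : ι → Matrix κ n ℂ) : Matrix n n ℂ →CP Matrix κ κ ℂ where
  toFun M := ∑ i, K i * M * (K i)ᴴ
  map_add' M N := by simp only [Matrix.mul_add, Matrix.add_mul, Finset.sum_add_distrib]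
  map_smul' c M := by
    simp only [Matrix.mul_smul, Matrix.smul_mul, Finset.smul_sum, RingHom.id_apply]
  map_cstarMatrix_nonneg' k M hM := by
    rw [← posSemidef_cstarMatrixCompEquiv_iff] at hM ⊢
    convert Matrix.posSemidef_sum Finset.univ
      fun i _ => hM.mul_mul_conjTranspose_same ((1 : Matrix (Fin k) (Fin k) ℂ) ⊗ₖ K i) using 1
    ext a b
    rw [cstarMatrixCompEquiv_apply, Matrix.sum_apply]
    change (∑ i, K i * M a.1 b.1 * (K i)ᴴ) a.2 b.2 = _
    rw [Matrix.sum_apply]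
    refine Finset.sum_congr rfl fun i _ => ?_
    simp only [Matrix.mul_apply, Fintype.sum_prod_type, Matrix.one_apply, Finset.sum_mul,
      Matrix.kroneckerMap_apply, Matrix.conjTranspose_apply, ite_mul, one_mul, zero_mul,
      apply_ite star, star_zero, mul_ite, mul_zero, cstarMatrixCompEquiv_apply]
    simp

theorem krausMap_apply {ι : Type*} [Fintype ι] (K : ι → Matrix κ n ℂ) (M : Matrix n n ℂ) :
    krausMap K M = ∑ i, K i * M * (K i)ᴴ := rfl

theorem posSemidef_choi (E : Matrix n n ℂ →CP Matrix κ κ ℂ) :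
    (Matrix.of fun a b : n × κ => E (Matrix.single a.1 b.1 1) a.2 b.2).PosSemidef := by
  let Ω : CStarMatrix n n (Matrix n n ℂ) := CStarMatrix.ofMatrix fun x x' => Matrix.single x x' 1
  have hΩ : 0 ≤ Ω := by
    let ω : n × n → ℂ := fun a => if a.1 = a.2 then 1 else 0
    have hω : cstarMatrixCompEquiv n n Ω = Matrix.vecMulVec ω (star ω) := by
      ext a b
      change Matrix.single a.1 b.1 (1 : ℂ) a.2 b.2 = _
      simp only [Matrix.single_apply, Matrix.vecMulVec_apply, Pi.star_apply, ω]
      split_ifs <;> simp_all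
    rw [← posSemidef_cstarMatrixCompEquiv_iff, hω]
    exact Matrix.posSemidef_vecMulVec_self_star ω
  exact posSemidef_cstarMatrixCompEquiv_iff.2 (E.map_cstarMatrix_nonneg Ω hΩ)

theorem exists_gram_eq_of_posSemidef {ι : Type*} [Fintype ι] {A : Matrix ι ι ℂ}
    (hA : A.PosSemidef) : ∃ u : ι → EuclideanSpace ℂ ι, Matrix.gram ℂ u = A := by
  classical
  obtain ⟨B, rfl⟩ := CStarAlgebra.nonneg_iff_eq_star_mul_self.1 hA.nonneg
  refine ⟨fun a => WithLp.toLp 2 fun i => B i a, ?_⟩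
  ext a b
  simp only [Matrix.gram_apply, PiLp.inner_apply, RCLike.inner_apply']
  rfl

end CompletelyPositive

/-! ### Bessel bounds for rank-one Gram matrices -/

section Orthogonality

variable {Y H : Type*} [NormedAddCommGroup H] [InnerProductSpace ℂ H]

theorem norm_sq_sum_of_pairwise_orthogonal [Fintype Y] {v : Y → H}
    (hv : Pairwise fun y y' => inner ℂ (v y) (v y') = 0) :
    ‖∑ y, v y‖ ^ 2 = ∑ y, ‖v y‖ ^ 2 := by
  simp only [← inner_self_eq_norm_sq (𝕜 := ℂ), sum_inner, inner_sum, map_sum]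
  refine Finset.sum_congr rfl fun y _ => Finset.sum_eq_single y (fun y' _ hy => ?_) (by simp)
  rw [hv hy, map_zero]

theorem sum_norm_inner_sq_div_le [Fintype Y] {v : Y → H}
    (hv : Pairwise fun y y' => inner ℂ (v y) (v y') = 0) (c : H) :
    ∑ y, ‖inner ℂ (v y) c‖ ^ 2 / ‖v y‖ ^ 2 ≤ ‖c‖ ^ 2 := by
  classical
  have hon : Orthonormal ℂ fun y : {y // v y ≠ 0} => ((‖v y‖⁻¹ : ℝ) : ℂ) • v y := by
    refine ⟨fun y => ?_, fun y y' hy => ?_⟩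
    · rw [norm_smul, Complex.norm_real, norm_inv, norm_norm,
        inv_mul_cancel₀ (norm_ne_zero_iff.2 y.2)]
    · dsimp only
      rw [inner_smul_left, inner_smul_right, hv (Subtype.coe_ne_coe.2 hy), mul_zero, mul_zero]
  calc ∑ y, ‖inner ℂ (v y) c‖ ^ 2 / ‖v y‖ ^ 2
      = ∑ y with v y ≠ 0, ‖inner ℂ (v y) c‖ ^ 2 / ‖v y‖ ^ 2 := by
        refine (Finset.sum_filter_of_ne fun y _ hy => ?_).symm
        intro h
        simp [h] at hy
    _ = ∑ y : {y // v y ≠ 0}, ‖inner ℂ (((‖v y‖⁻¹ : ℝ) : ℂ) • v y) c‖ ^ 2 := by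
        rw [Finset.sum_subtype _ (p := fun y => v y ≠ 0) (by simp)]
        refine Finset.sum_congr rfl fun y _ => ?_
        rw [inner_smul_left, norm_mul, mul_pow, RCLike.norm_conj, Complex.norm_real, norm_inv,
          norm_norm, inv_pow, div_eq_inv_mul]
    _ ≤ ‖c‖ ^ 2 := hon.sum_inner_products_le c

theorem norm_sq_eq_of_inner_self_eq {w : H} {a : ℂ} {P : ℝ}
    (hw : inner ℂ w w = P * a * star a) : ‖w‖ ^ 2 = P * ‖a‖ ^ 2 := by
  rw [← inner_self_eq_norm_sq (𝕜 := ℂ), hw, mul_assoc, RCLike.star_def, Complex.mul_conj']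
  norm_cast

theorem exists_eq_star_smul_of_inner_eq {w : Y → H} {f : Y → ℂ} {P : ℝ} (hP : 0 ≤ P)
    (hw : ∀ y y', inner ℂ (w y) (w y') = P * f y * star (f y')) :
    ∃ c : H, ‖c‖ ^ 2 ≤ P ∧ ∀ y, w y = star (f y) • c := by
  by_cases hf : ∃ y₀, f y₀ ≠ 0
  · obtain ⟨y₀, hy₀⟩ := hf
    refine ⟨(star (f y₀))⁻¹ • w y₀, ?_, fun y => ?_⟩
    · rw [norm_smul, norm_inv, norm_star, mul_pow, norm_sq_eq_of_inner_self_eq (hw y₀ y₀), inv_pow,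
        mul_left_comm, inv_mul_cancel₀ (pow_ne_zero 2 (norm_ne_zero_iff.2 hy₀)), mul_one]
    · rw [← sub_eq_zero, ← inner_self_eq_zero (𝕜 := ℂ)]
      simp only [inner_sub_left, inner_sub_right, inner_smul_left, inner_smul_right, hw]
      simp only [RCLike.star_def, RingHomCompTriple.comp_apply, RingHom.id_apply, map_inv₀]
      field_simp
      ring
  · push Not at hf
    refine ⟨0, by simpa using hP, fun y => ?_⟩
    rw [smul_zero, ← inner_self_eq_zero (𝕜 := ℂ), hw, hf, mul_zero, zero_mul]

theorem sum_norm_sq_div_le_of_rank_one_gram {X : Type*} [Fintype X] [Fintype Y]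
    {z : X → Y → H} {f : Y → ℂ} {P : ℝ} (hP : 0 ≤ P)
    (hz : ∀ y, Pairwise fun x x' => inner ℂ (z x y) (z x' y) = 0)
    (hz' : ∀ x, Pairwise fun y y' => inner ℂ (z x y) (z x y') = 0)
    (hw : ∀ y y', inner ℂ (∑ x, z x y) (∑ x, z x y') = P * f y * star (f y')) (x : X) :
    ∑ y, ‖z x y‖ ^ 2 / ‖f y‖ ^ 2 ≤ P := by
  obtain ⟨c, hcP, hc⟩ := exists_eq_star_smul_of_inner_eq hP hw
  have hzc (y) : ‖f y‖ * ‖inner ℂ (z x y) c‖ = ‖z x y‖ ^ 2 := by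
    have hsum : inner ℂ (z x y) (∑ x', z x' y) = inner ℂ (z x y) (z x y) := by
      rw [inner_sum]
      exact Finset.sum_eq_single x (fun x' _ hx => hz y hx.symm) (by simp)
    rw [← norm_star (f y), ← norm_mul, ← inner_smul_right, ← hc, hsum, inner_self_eq_norm_sq_to_K,
      norm_pow, RCLike.norm_ofReal, abs_norm]
  have hterm (y) : ‖z x y‖ ^ 2 / ‖f y‖ ^ 2 ≤ ‖inner ℂ (z x y) c‖ ^ 2 / ‖z x y‖ ^ 2 := by
    rcases eq_or_ne (f y) 0 with hf | hf
    · rw [hf, norm_zero, zero_pow two_ne_zero, div_zero]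
      positivity
    rcases eq_or_ne (z x y) 0 with hzy | hzy
    · simp [hzy]
    · refine le_of_eq ?_
      rw [div_eq_div_iff (pow_ne_zero 2 (norm_ne_zero_iff.2 hf))
        (pow_ne_zero 2 (norm_ne_zero_iff.2 hzy)), ← hzc]
      ring
  calc ∑ y, ‖z x y‖ ^ 2 / ‖f y‖ ^ 2 ≤ ∑ y, ‖inner ℂ (z x y) c‖ ^ 2 / ‖z x y‖ ^ 2 :=
        Finset.sum_le_sum fun y _ => hterm y
    _ ≤ ‖c‖ ^ 2 := sum_norm_inner_sq_div_le (hz' x) c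
    _ ≤ P := hcP

end Orthogonality

theorem sum_mul_sum_le_mul_topSum {X : Type*} [Fintype X] {n k : ℕ} {W : X → Fin n → ℝ}
    {r : Fin n → ℝ} {P : ℝ} {b : X → ℝ} (hW : ∀ x y, 0 ≤ W x y) (hr : 0 ≤ r) (hP : 0 ≤ P)
    (hrow : ∀ y, ∑ x, W x y ≤ P * r y) (hcol : ∀ x, ∑ y, W x y / r y ≤ P)
    (hb : b ∈ Set.Icc 0 1) (hbk : ∑ x, b x ≤ k) :
    ∑ x, b x * ∑ y, W x y ≤ P * topSum k r := by
  have hle (y) : ∑ x, b x * W x y ≤ P * r y :=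
    (Finset.sum_le_sum fun x _ => mul_le_of_le_one_left (hW x y) (hb.2 x)).trans (hrow y)
  have hnonneg (y) : 0 ≤ ∑ x, b x * W x y :=
    Finset.sum_nonneg fun x _ => mul_nonneg (hb.1 x) (hW x y)
  let a : Fin n → ℝ := fun y => (∑ x, b x * W x y) / (P * r y)
  have ha : a ∈ Set.Icc 0 1 :=
    ⟨fun y => div_nonneg (hnonneg y) (mul_nonneg hP (hr y)),
      fun y => div_le_one_of_le₀ (hle y) (mul_nonneg hP (hr y))⟩
  have hak : ∑ y, a y ≤ k := calc
    ∑ y, a y = ∑ x, b x * ((∑ y, W x y / r y) / P) := by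
      simp only [a, Finset.sum_div, Finset.mul_sum]
      rw [Finset.sum_comm]
      refine Finset.sum_congr rfl fun x _ => Finset.sum_congr rfl fun y _ => ?_
      rw [div_div, mul_div_assoc, mul_comm P]
    _ ≤ ∑ x, b x := Finset.sum_le_sum fun x _ =>
      mul_le_of_le_one_right (hb.1 x) (div_le_one_of_le₀ (hcol x) hP)
    _ ≤ k := hbk
  have hmul (y) : ∑ x, b x * W x y = P * (a y * r y) := by
    rw [mul_left_comm, ← mul_comm (P * r y)]
    refine (mul_div_cancel_of_imp' fun h => ?_).symm
    exact le_antisymm (h ▸ hle y) (hnonneg y)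
  calc ∑ x, b x * ∑ y, W x y = P * (a ⬝ᵥ r) := by
        simp only [Finset.mul_sum, dotProduct, ← hmul]
        exact Finset.sum_comm
    _ ≤ P * topSum k r := mul_le_mul_of_nonneg_left (dotProduct_le_topSum ha hak hr) hP

/-! ### Necessity -/

theorem pureState_eq_sum_single {d : ℕ} (ψ : EuclideanSpace ℂ (Fin d)) :
    pureState ψ = ∑ x, ∑ x', (ψ x * star (ψ x')) • Matrix.single x x' (1 : ℂ) := by
  conv_lhs => rw [Matrix.matrix_eq_sum_single (pureState ψ)]
  simp only [pureState, Matrix.vecMulVec_apply, Pi.star_apply, Matrix.smul_single, smul_eq_mul,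
    mul_one]

theorem trace_pureState {d : ℕ} (ψ : EuclideanSpace ℂ (Fin d)) :
    (pureState ψ).trace = ((∑ x, cohDist ψ x : ℝ) : ℂ) := by
  simp only [Matrix.trace, pureState, Matrix.diag_apply, Matrix.vecMulVec_apply, Pi.star_apply,
    RCLike.star_def, Complex.mul_conj', cohDist, Complex.ofReal_sum, Complex.ofReal_pow]

theorem trace_heraldedState {m d : ℕ} (p : Fin m → ℝ) (φ : Fin m → EuclideanSpace ℂ (Fin d)) :
    (heraldedState p φ).trace =
      ((∑ i, (∑ j, p j • decreasing (cohDist (φ j))) i : ℝ) : ℂ) := by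
  have hsum : ∑ i, (∑ j, p j • decreasing (cohDist (φ j))) i = ∑ j, p j * ∑ y, cohDist (φ j) y := by
    simp only [Finset.sum_apply, Pi.smul_apply, smul_eq_mul]
    rw [Finset.sum_comm]
    simp only [← Finset.mul_sum, sum_decreasing]
  rw [hsum, Complex.ofReal_sum]
  simp only [heraldedState, Matrix.trace_sum, Matrix.trace_smul, Matrix.trace_kronecker,
    Matrix.trace_single_eq_same, one_mul, trace_pureState, smul_eq_mul, Complex.ofReal_mul]

theorem heraldedState_apply {m d : ℕ} (p : Fin m → ℝ) (φ : Fin m → EuclideanSpace ℂ (Fin d))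
    (j : Fin m) (y y' : Fin d) :
    heraldedState p φ (j, y) (j, y') = p j * φ j y * star (φ j y') := by
  simp only [heraldedState, Matrix.sum_apply, Matrix.smul_apply, Matrix.kroneckerMap_apply,
    smul_eq_mul]
  rw [Finset.sum_eq_single j (fun i _ hi => by simp [hi]) (by simp), Matrix.single_apply_same,
    one_mul, mul_assoc]
  rfl

theorem IsDIO.apply_single_apply_self {ι κ : Type*} [Fintype ι] [DecidableEq ι] [Fintype κ]
    [DecidableEq κ] {E : Matrix ι ι ℂ →CP Matrix κ κ ℂ} (hE : IsDIO E) {x x' : ι} (hx : x ≠ x')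
    (a : κ) : E (Matrix.single x x' 1) a a = 0 := by
  have hdephase : dephase (Matrix.single x x' (1 : ℂ)) = 0 := by
    rw [dephase, Matrix.diag_single_of_ne _ _ _ hx, Matrix.diagonal_zero']
  have hcov := hE.dephasing_covariant (Matrix.single x x' 1)
  rw [hdephase, map_zero] at hcov
  simpa only [dephase, Matrix.diagonal_apply_eq, Matrix.diag_apply,
    Matrix.zero_apply] using congrFun₂ hcov a a

theorem IsDIO.apply_single_self_apply {ι κ : Type*} [Fintype ι] [DecidableEq ι] [Fintype κ]
    [DecidableEq κ] {E : Matrix ι ι ℂ →CP Matrix κ κ ℂ} (hE : IsDIO E) (x : ι) {a a' : κ}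
    (ha : a ≠ a') : E (Matrix.single x x 1) a a' = 0 := by
  have hdephase : dephase (Matrix.single x x (1 : ℂ)) = Matrix.single x x 1 := by
    rw [dephase, Matrix.diag_single_same, Matrix.diagonal_single]
  rw [← hdephase, ← hE.dephasing_covariant, dephase, Matrix.diagonal_apply_ne _ ha]

/- Covariance makes the Gram vectors `u (x, a)` of the Choi matrix orthogonal along rows and
columns; the vectors `∑ x, star (ψ x) • u (x, a)` have Gram matrix `E (pureState ψ)`. -/
theorem IsDIO.exists_orthogonal_decomposition {d : ℕ} {κ : Type*} [Fintype κ] [DecidableEq κ]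
    {E : Matrix (Fin d) (Fin d) ℂ →CP Matrix κ κ ℂ} (hE : IsDIO E)
    (ψ : EuclideanSpace ℂ (Fin d)) :
    ∃ z : Fin d → κ → EuclideanSpace ℂ (Fin d × κ),
      (∀ a, Pairwise fun x x' => inner ℂ (z x a) (z x' a) = 0) ∧
      (∀ x, Pairwise fun a a' => inner ℂ (z x a) (z x a') = 0) ∧
      (∀ x, ∑ a, ‖z x a‖ ^ 2 = cohDist ψ x) ∧
      ∀ a a', inner ℂ (∑ x, z x a) (∑ x, z x a') = E (pureState ψ) a a' := by
  obtain ⟨u, hu⟩ := exists_gram_eq_of_posSemidef (posSemidef_choi E)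
  have hinner (x x' a a') : inner ℂ (u (x, a)) (u (x', a')) = E (Matrix.single x x' 1) a a' :=
    congrFun₂ hu (x, a) (x', a')
  have hnorm (x) : ∑ a, ‖u (x, a)‖ ^ 2 = 1 := by
    have htrace := hE.trace_preserving (Matrix.single x x 1)
    rw [Matrix.trace_single_eq_same] at htrace
    simpa only [Matrix.trace, Matrix.diag_apply, ← hinner, map_sum, inner_self_eq_norm_sq,
      RCLike.one_re] using congrArg RCLike.re htrace
  refine ⟨fun x a => star (ψ x) • u (x, a), fun a x x' hx => ?_, fun x a a' ha => ?_, fun x => ?_,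
    fun a a' => ?_⟩
  · simp only [inner_smul_left, inner_smul_right, hinner, hE.apply_single_apply_self hx, mul_zero]
  · simp only [inner_smul_left, inner_smul_right, hinner, hE.apply_single_self_apply x ha, mul_zero]
  · simp only [norm_smul, mul_pow, ← Finset.mul_sum, hnorm, norm_star, mul_one, cohDist]
  · simp only [pureState_eq_sum_single, map_sum, map_smul, Matrix.sum_apply, Matrix.smul_apply,
      ← hinner, sum_inner, inner_sum, inner_smul_left, inner_smul_right, smul_eq_mul,
      RCLike.star_def, Complex.conj_conj, Finset.mul_sum]
    rw [Finset.sum_comm]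
    simp only [mul_assoc, mul_left_comm]

theorem topSum_cohDist_le_of_isDIO {d_in d_out m : ℕ} {ψ : EuclideanSpace ℂ (Fin d_in)}
    {p : Fin m → ℝ} (hp : 0 ≤ p) {φ : Fin m → EuclideanSpace ℂ (Fin d_out)}
    {E : Matrix (Fin d_in) (Fin d_in) ℂ →CP Matrix (Fin m × Fin d_out) (Fin m × Fin d_out) ℂ}
    (hE : IsDIO E) (hEψ : E (pureState ψ) = heraldedState p φ) (k : ℕ) :
    topSum k (cohDist ψ) ≤ topSum k (∑ j, p j • decreasing (cohDist (φ j))) := by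
  obtain ⟨z, hz, hz', hψ, hw⟩ := hE.exists_orthogonal_decomposition ψ
  obtain ⟨b, hb, hbk, hbψ⟩ := exists_dotProduct_eq_topSum k (cohDist ψ)
  have hblock (j y y') :
      inner ℂ (∑ x, z x (j, y)) (∑ x, z x (j, y')) = p j * φ j y * star (φ j y') := by
    rw [hw, hEψ, heraldedState_apply]
  have hrow (j y) : ∑ x, ‖z x (j, y)‖ ^ 2 = p j * cohDist (φ j) y := by
    rw [← norm_sq_sum_of_pairwise_orthogonal (hz (j, y)),
      norm_sq_eq_of_inner_self_eq (hblock j y y), cohDist]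
  have hcol (j x) : ∑ y, ‖z x (j, y)‖ ^ 2 / cohDist (φ j) y ≤ p j :=
    sum_norm_sq_div_le_of_rank_one_gram (z := fun x y => z x (j, y)) (hp j) (fun y => hz (j, y))
      (fun x y y' hy => hz' x fun h => hy (congrArg Prod.snd h)) (hblock j) x
  calc topSum k (cohDist ψ) = ∑ j, ∑ x, b x * ∑ y, ‖z x (j, y)‖ ^ 2 := by
        simp only [← hbψ, dotProduct, ← hψ, Fintype.sum_prod_type]
        rw [Finset.sum_comm]
        simp only [Finset.mul_sum]
    _ ≤ ∑ j, p j * topSum k (cohDist (φ j)) := Finset.sum_le_sum fun j _ =>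
        sum_mul_sum_le_mul_topSum (fun _ _ => sq_nonneg _) (fun _ => sq_nonneg _) (hp j)
          (fun y => (hrow j y).le) (hcol j) hb hbk
    _ = topSum k (∑ j, p j • decreasing (cohDist (φ j))) :=
        (topSum_sum_smul_decreasing k hp _).symm

theorem majorized_of_isDIO {d_in d_out m : ℕ} {ψ : EuclideanSpace ℂ (Fin d_in)}
    {p : Fin m → ℝ} (hp : 0 ≤ p) {φ : Fin m → EuclideanSpace ℂ (Fin d_out)}
    {E : Matrix (Fin d_in) (Fin d_in) ℂ →CP Matrix (Fin m × Fin d_out) (Fin m × Fin d_out) ℂ}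
    (hE : IsDIO E) (hEψ : E (pureState ψ) = heraldedState p φ) :
    Majorized (cohDist ψ) (∑ j, p j • decreasing (cohDist (φ j))) := by
  have htrace : (heraldedState p φ).trace = (pureState ψ).trace := hEψ ▸ hE.trace_preserving _
  rw [trace_heraldedState, trace_pureState, Complex.ofReal_inj] at htrace
  exact majorized_of_topSum_le (fun _ => sq_nonneg _)
    (Finset.sum_nonneg fun j _ => smul_nonneg (hp j) fun _ => sq_nonneg _)
    (topSum_cohDist_le_of_isDIO hp hE hEψ) htrace.symm

/-! ### Sufficiency -/

section StrictlyIncoherent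

variable {n κ : Type*}

/-- A strictly incoherent matrix has at most one nonzero entry in each row and each column. As Kraus
operators, such matrices give dephasing-covariant maps. -/
def IsStrictlyIncoherent (K : Matrix κ n ℂ) : Prop :=
  Relator.BiUnique fun y x => K y x ≠ 0

theorem IsStrictlyIncoherent.mono {K L : Matrix κ n ℂ} (hL : IsStrictlyIncoherent L)
    (h : ∀ y x, K y x ≠ 0 → L y x ≠ 0) : IsStrictlyIncoherent K :=
  ⟨fun _ _ _ hy hy' => hL.1 (h _ _ hy) (h _ _ hy'), fun _ _ _ hx hx' => hL.2 (h _ _ hx) (h _ _ hx')⟩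

theorem isStrictlyIncoherent_single [DecidableEq n] [DecidableEq κ] (y : κ) (x : n) (c : ℂ) :
    IsStrictlyIncoherent (Matrix.single y x c) := by
  have hindex {y' x'} (h : Matrix.single y x c y' x' ≠ 0) : y = y' ∧ x = x' := by
    by_contra hne
    exact h (Matrix.single_apply_of_ne _ _ _ _ _ hne)
  exact ⟨fun _ _ _ h h' => (hindex h).1.symm.trans (hindex h').1,
    fun _ _ _ h h' => (hindex h).2.symm.trans (hindex h').2⟩

theorem IsStrictlyIncoherent.conjTranspose_mul_self [Fintype κ] [DecidableEq n]
    {K : Matrix κ n ℂ} (hK : IsStrictlyIncoherent K) :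
    Kᴴ * K = Matrix.diagonal fun x => ((∑ y, ‖K y x‖ ^ 2 : ℝ) : ℂ) := by
  ext x x'
  rw [Matrix.mul_apply]
  by_cases hx : x = x'
  · subst hx
    simp only [Matrix.conjTranspose_apply, RCLike.star_def, Complex.conj_mul',
      Matrix.diagonal_apply_eq, Complex.ofReal_sum, Complex.ofReal_pow]
  · rw [Matrix.diagonal_apply_ne _ hx]
    refine Finset.sum_eq_zero fun y _ => ?_
    by_contra h
    exact hx (hK.2 (star_ne_zero.1 (left_ne_zero_of_mul h)) (right_ne_zero_of_mul h))

theorem IsStrictlyIncoherent.dephase_mul_mul_conjTranspose [Fintype n] [DecidableEq n]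
    [DecidableEq κ] {K : Matrix κ n ℂ} (hK : IsStrictlyIncoherent K) (M : Matrix n n ℂ) :
    dephase (K * M * Kᴴ) = K * dephase M * Kᴴ := by
  have hdephase (y y' : κ) :
      (K * dephase M * Kᴴ) y y' = ∑ x, K y x * M x x * star (K y' x) := by
    rw [Matrix.mul_apply, dephase]
    simp only [Matrix.mul_diagonal, Matrix.diag_apply, Matrix.conjTranspose_apply]
  ext y y'
  rw [hdephase]
  by_cases hy : y = y'
  · subst hy
    rw [dephase, Matrix.diagonal_apply_eq, Matrix.diag_apply, Matrix.mul_apply]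
    refine Finset.sum_congr rfl fun x _ => ?_
    rw [Matrix.conjTranspose_apply, Matrix.mul_apply, Finset.sum_mul]
    refine Finset.sum_eq_single x (fun x' _ hx => ?_) (by simp)
    by_contra h
    exact hx (hK.2 (left_ne_zero_of_mul (left_ne_zero_of_mul h))
      (star_ne_zero.1 (right_ne_zero_of_mul h)))
  · rw [dephase, Matrix.diagonal_apply_ne _ hy]
    refine (Finset.sum_eq_zero fun x _ => ?_).symm
    by_contra h
    exact hy (hK.1 (left_ne_zero_of_mul (left_ne_zero_of_mul h))
      (star_ne_zero.1 (right_ne_zero_of_mul h)))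

theorem isDIO_krausMap {ι : Type*} [Fintype ι] [Fintype n] [DecidableEq n] [Fintype κ]
    [DecidableEq κ] {K : ι → Matrix κ n ℂ} (hK : ∀ i, IsStrictlyIncoherent (K i))
    (hnorm : ∀ x, ∑ i, ∑ y, ‖K i y x‖ ^ 2 = 1) : IsDIO (krausMap K) where
  trace_preserving M := by
    have hcomplete : ∑ i, (K i)ᴴ * K i = 1 := by
      ext x x'
      simp only [(hK _).conjTranspose_mul_self, Matrix.sum_apply, Matrix.diagonal_apply,
        Matrix.one_apply]
      split_ifs
      · exact_mod_cast hnorm x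
      · exact Finset.sum_const_zero
    calc (krausMap K M).trace = ((∑ i, (K i)ᴴ * K i) * M).trace := by
          simp only [krausMap_apply, Matrix.trace_sum, Matrix.sum_mul, Matrix.trace_mul_cycle (K _)]
      _ = M.trace := by rw [hcomplete, Matrix.one_mul]
  dephasing_covariant M := by
    have hsum : dephase (∑ i, K i * M * (K i)ᴴ) = ∑ i, dephase (K i * M * (K i)ᴴ) := by
      ext a b
      simp only [dephase, Matrix.diagonal_apply, Matrix.diag_apply, Matrix.sum_apply]
      split_ifs
      · rfl
      · exact Finset.sum_const_zero.symm
    simp only [krausMap_apply, hsum, (hK _).dephase_mul_mul_conjTranspose]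

theorem krausMap_pureState {ι : Type*} [Fintype ι] [Fintype κ] [DecidableEq κ] {d : ℕ}
    (K : ι → Matrix κ (Fin d) ℂ) (ψ : EuclideanSpace ℂ (Fin d)) :
    krausMap K (pureState ψ) =
      ∑ i, Matrix.vecMulVec (K i *ᵥ ψ.ofLp) (star (K i *ᵥ ψ.ofLp)) := by
  simp only [krausMap_apply, pureState, Matrix.mul_vecMulVec, Matrix.vecMulVec_mul,
    Matrix.star_mulVec]

theorem eq_zero_of_sum_norm_sq_eq_zero {ι : Type*} [Fintype ι] [Fintype κ] {a : ι → κ → ℂ}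
    (h : ∑ i, ∑ y, ‖a i y‖ ^ 2 = 0) (i : ι) (y : κ) : a i y = 0 := by
  have hi := (Finset.sum_eq_zero_iff_of_nonneg fun i _ =>
    Finset.sum_nonneg fun y _ => sq_nonneg ‖a i y‖).1 h i (Finset.mem_univ i)
  simpa only [sq_eq_zero_iff, norm_eq_zero] using
    (Finset.sum_eq_zero_iff_of_nonneg fun y _ => sq_nonneg ‖a i y‖).1 hi y (Finset.mem_univ y)

section PreparingKraus

variable {ι : Type*} [DecidableEq κ] {d : ℕ} {ψ : EuclideanSpace ℂ (Fin d)}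
  {A : ι → Matrix κ (Fin d) ℂ} {y₀ : κ}

/-- Kraus operators preparing the vectors `A i *ᵥ 1` from `ψ`: column `x` of `A i` is divided by
`ψ x`. The family is completed to a trace-preserving one by operators sending each basis vector
outside the support of `ψ` to that of index `y₀`. -/
noncomputable def preparingKraus (ψ : EuclideanSpace ℂ (Fin d)) (A : ι → Matrix κ (Fin d) ℂ)
    (y₀ : κ) : ι ⊕ Fin d → Matrix κ (Fin d) ℂ :=
  Sum.elim (fun i => Matrix.of fun y x => A i y x / ψ x)
    fun x₀ => Matrix.single y₀ x₀ (if ψ x₀ = 0 then 1 else 0)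

theorem isStrictlyIncoherent_preparingKraus (hA : ∀ i, IsStrictlyIncoherent (A i)) :
    ∀ i, IsStrictlyIncoherent (preparingKraus ψ A y₀ i)
  | .inl i => (hA i).mono fun y x => by simp +contextual [preparingKraus]
  | .inr _ => isStrictlyIncoherent_single _ _ _

theorem sum_norm_sq_preparingKraus [Fintype ι] [Fintype κ] {x : Fin d}
    (hnorm : ∑ i, ∑ y, ‖A i y x‖ ^ 2 = cohDist ψ x) :
    ∑ i, ∑ y, ‖preparingKraus ψ A y₀ i y x‖ ^ 2 = 1 := by
  have hl : ∑ i, ∑ y, ‖preparingKraus ψ A y₀ (.inl i) y x‖ ^ 2 = cohDist ψ x / ‖ψ x‖ ^ 2 := by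
    simp only [preparingKraus, Sum.elim_inl, Matrix.of_apply, norm_div, div_pow,
      ← Finset.sum_div, hnorm]
  have hr : ∑ x₀, ∑ y, ‖preparingKraus ψ A y₀ (.inr x₀) y x‖ ^ 2 = if ψ x = 0 then 1 else 0 := by
    rw [Finset.sum_eq_single x (fun x₀ _ hx => by simp [preparingKraus, hx]) (by simp),
      Finset.sum_eq_single y₀ (fun y _ hy => by simp [preparingKraus, hy.symm]) (by simp)]
    simp only [preparingKraus, Sum.elim_inr, Matrix.single_apply_same]
    split_ifs <;> simp
  rw [Fintype.sum_sum_type, hl, hr, cohDist]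
  split_ifs with hx <;> simp [hx]

theorem preparingKraus_inl_mulVec (hA : ∀ i y x, ψ x = 0 → A i y x = 0) (i : ι) :
    preparingKraus ψ A y₀ (.inl i) *ᵥ ψ.ofLp = A i *ᵥ 1 := by
  ext y
  simp only [Matrix.mulVec, dotProduct]
  refine Finset.sum_congr rfl fun x _ => ?_
  rw [Pi.one_apply, mul_one]
  exact div_mul_cancel_of_imp (hA i y x)

theorem preparingKraus_inr_mulVec (x₀ : Fin d) :
    preparingKraus ψ A y₀ (.inr x₀) *ᵥ ψ.ofLp = 0 := by
  simp only [preparingKraus, Sum.elim_inr, Matrix.single_mulVec]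
  split_ifs with hx <;> simp [hx]

end PreparingKraus

theorem exists_isDIO_of_sum_norm_sq_eq_cohDist {ι : Type*} [Fintype ι] [Fintype κ]
    [DecidableEq κ] {d : ℕ} {ψ : EuclideanSpace ℂ (Fin d)} (hψ : ψ ≠ 0)
    {A : ι → Matrix κ (Fin d) ℂ} (hA : ∀ i, IsStrictlyIncoherent (A i))
    (hnorm : ∀ x, ∑ i, ∑ y, ‖A i y x‖ ^ 2 = cohDist ψ x) :
    ∃ E : Matrix (Fin d) (Fin d) ℂ →CP Matrix κ κ ℂ, IsDIO E ∧
      E (pureState ψ) = ∑ i, Matrix.vecMulVec (A i *ᵥ 1) (star (A i *ᵥ 1)) := by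
  obtain ⟨x₁, hx₁⟩ : ∃ x, ψ x ≠ 0 := by
    by_contra! h
    exact hψ (PiLp.ext h)
  obtain ⟨y₀⟩ : Nonempty κ := by
    by_contra h
    rw [not_nonempty_iff] at h
    exact hx₁ (by simpa [cohDist] using (hnorm x₁).symm)
  have hvanish (i y x) (hx : ψ x = 0) : A i y x = 0 :=
    eq_zero_of_sum_norm_sq_eq_zero (a := fun i y => A i y x)
      (by simpa [cohDist, hx] using hnorm x) i y
  refine ⟨krausMap (preparingKraus ψ A y₀), isDIO_krausMap
    (isStrictlyIncoherent_preparingKraus hA) fun x => sum_norm_sq_preparingKraus (hnorm x), ?_⟩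
  simp only [krausMap_pureState, Fintype.sum_sum_type, preparingKraus_inl_mulVec hvanish,
    preparingKraus_inr_mulVec, Matrix.zero_vecMulVec, Finset.sum_const_zero, add_zero]

end StrictlyIncoherent

section Matching

variable {n κ τ : Type*} [DecidableEq τ] {α : n → τ} {β : κ → τ} {f : κ → ℂ}

/-- The matrix transporting amplitudes along a matching of columns and rows: the entry `f y` of row
`y` stands in the column `x` with the same label, `α x = β y`. -/
def matchingMatrix (α : n → τ) (β : κ → τ) (f : κ → ℂ) : Matrix κ n ℂ :=
  Matrix.of fun y x => if α x = β y then f y else 0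

theorem isStrictlyIncoherent_matchingMatrix (hα : Function.Injective α)
    (hβ : Set.InjOn β (Function.support f)) : IsStrictlyIncoherent (matchingMatrix α β f) := by
  have hentry {y x} (h : matchingMatrix α β f y x ≠ 0) : α x = β y ∧ f y ≠ 0 :=
    ite_ne_right_iff.1 h
  exact ⟨fun _ _ _ h h' => hβ (hentry h).2 (hentry h').2 ((hentry h).1.symm.trans (hentry h').1),
    fun _ _ _ h h' => hα ((hentry h).1.trans (hentry h').1.symm)⟩

theorem matchingMatrix_mulVec_one [Fintype n] (hα : Function.Injective α)
    (hf : ∀ y ∈ Function.support f, β y ∈ Set.range α) : matchingMatrix α β f *ᵥ 1 = f := by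
  ext y
  simp only [matchingMatrix, Matrix.mulVec, dotProduct, Matrix.of_apply, Pi.one_apply, mul_one]
  rcases eq_or_ne (f y) 0 with hy | hy
  · simp only [hy, ite_self, Finset.sum_const_zero]
  · obtain ⟨x, hx⟩ := hf y hy
    rw [Finset.sum_eq_single x (fun x' _ hx' => if_neg fun h => hx' (hα (h.trans hx.symm)))
      (by simp), if_pos hx]

theorem norm_sq_matchingMatrix_apply (y : κ) (x : n) :
    ‖matchingMatrix α β f y x‖ ^ 2 = if α x = β y then ‖f y‖ ^ 2 else 0 := by
  simp only [matchingMatrix, Matrix.of_apply]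
  split_ifs <;> simp

theorem exists_isDIO_of_matching {ι : Type*} [Fintype ι] [Fintype κ] [DecidableEq κ] {d : ℕ}
    {ψ : EuclideanSpace ℂ (Fin d)} (hψ : ψ ≠ 0) {α : ι → Fin d → τ} {f : ι → κ → ℂ}
    (hα : ∀ i, Function.Injective (α i)) (hβ : ∀ i, Set.InjOn β (Function.support (f i)))
    (hf : ∀ i, ∀ y ∈ Function.support (f i), β y ∈ Set.range (α i))
    (hnorm : ∀ x, ∑ i, ∑ y, (if α i x = β y then ‖f i y‖ ^ 2 else 0) = cohDist ψ x) :
    ∃ E : Matrix (Fin d) (Fin d) ℂ →CP Matrix κ κ ℂ, IsDIO E ∧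
      E (pureState ψ) = ∑ i, Matrix.vecMulVec (f i) (star (f i)) := by
  have hE := exists_isDIO_of_sum_norm_sq_eq_cohDist hψ (A := fun i => matchingMatrix (α i) β (f i))
    (fun i => isStrictlyIncoherent_matchingMatrix (hα i) (hβ i))
    (by simpa only [norm_sq_matchingMatrix_apply] using hnorm)
  simpa only [matchingMatrix_mulVec_one (hα _) (hf _)] using hE

end Matching

section Branch

variable {J : Type*} [DecidableEq J] {d : ℕ}

/-- The unnormalized branch vector `√c |j⟩ ⊗ |φ⟩`. -/
noncomputable def branchVector (c : ℝ) (j : J) (φ : EuclideanSpace ℂ (Fin d)) : J × Fin d → ℂ :=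
  fun b => if b.1 = j then Real.sqrt c * φ b.2 else 0

theorem norm_sq_branchVector {c : ℝ} (hc : 0 ≤ c) (j : J) (φ : EuclideanSpace ℂ (Fin d))
    (b : J × Fin d) :
    ‖branchVector c j φ b‖ ^ 2 = if b.1 = j then c * cohDist φ b.2 else 0 := by
  unfold branchVector
  split_ifs
  · rw [norm_mul, mul_pow, Complex.norm_real, Real.norm_eq_abs, sq_abs, Real.sq_sqrt hc, cohDist]
  · simp

theorem vecMulVec_branchVector {c : ℝ} (hc : 0 ≤ c) (j : J) (φ : EuclideanSpace ℂ (Fin d)) :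
    Matrix.vecMulVec (branchVector c j φ) (star (branchVector c j φ)) =
      (c : ℂ) • (Matrix.single j j (1 : ℂ) ⊗ₖ pureState φ) := by
  have hsqrt : (Real.sqrt c : ℂ) * Real.sqrt c = c := by exact_mod_cast Real.mul_self_sqrt hc
  ext ⟨j₁, y₁⟩ ⟨j₂, y₂⟩
  simp only [Matrix.vecMulVec_apply, Pi.star_apply, branchVector, Matrix.smul_apply,
    Matrix.kroneckerMap_apply, pureState, Matrix.single_apply, smul_eq_mul, ← hsqrt,
    eq_comm (a := j)]
  by_cases h₁ : j₁ = j <;> by_cases h₂ : j₂ = j <;>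
    simp only [h₁, h₂, ↓reduceIte, star_mul', star_zero, RCLike.star_def, Complex.conj_ofReal,
      mul_zero, zero_mul, one_mul, and_self, and_true, and_false]
  ring

theorem sum_vecMulVec_branchVector {ι : Type*} [Fintype ι] {m : ℕ} {t : ι → ℝ} (ht : 0 ≤ t)
    (ht_sum : ∑ e, t e = 1) {p : Fin m → ℝ} (hp : 0 ≤ p)
    (φ : Fin m → EuclideanSpace ℂ (Fin d)) :
    ∑ i : ι × Fin m, Matrix.vecMulVec (branchVector (t i.1 * p i.2) i.2 (φ i.2))
      (star (branchVector (t i.1 * p i.2) i.2 (φ i.2))) = heraldedState p φ := by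
  simp only [vecMulVec_branchVector (mul_nonneg (ht _) (hp _)), Fintype.sum_prod_type,
    Complex.ofReal_mul, mul_smul, ← Finset.smul_sum, ← Finset.sum_smul]
  rw [← Complex.ofReal_sum, ht_sum, Complex.ofReal_one, one_smul, heraldedState]

end Branch

/-- The position of `y` among `N ≥ n` slots when the entries of `v` are put in non-increasing order
and padded by zeros. -/
noncomputable def sortedPosition {n N : ℕ} (h : n ≤ N) (v : Fin n → ℝ) (y : Fin n) : Fin N :=
  Fin.castLE h ((Tuple.sort fun i => -v i).symm y)

theorem sortedPosition_injective {n N : ℕ} (h : n ≤ N) (v : Fin n → ℝ) :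
    Function.Injective (sortedPosition h v) :=
  (Fin.castLE_injective h).comp (Equiv.injective _)

theorem padZeros_sum_smul_decreasing {J : Type*} [Fintype J] {n N : ℕ} (h : n ≤ N) (p : J → ℝ)
    (v : J → Fin n → ℝ) (i : Fin N) :
    padZeros N (∑ j, p j • decreasing (v j)) i =
      ∑ b : J × Fin n, if i = sortedPosition h (v b.1) b.2 then p b.1 * v b.1 b.2 else 0 := by
  calc padZeros N (∑ j, p j • decreasing (v j)) i
      = ∑ j, ∑ l, if i = Fin.castLE h l then p j * decreasing (v j) l else 0 := by
        simp only [padZeros_apply_eq_sum h, Finset.sum_apply, Pi.smul_apply, smul_eq_mul]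
        rw [Finset.sum_comm]
        refine Finset.sum_congr rfl fun l _ => ?_
        split_ifs <;> simp
    _ = ∑ j, ∑ y, if i = sortedPosition h (v j) y then p j * v j y else 0 := by
        refine Finset.sum_congr rfl fun j _ => ?_
        rw [← Equiv.sum_comp (Tuple.sort fun i => -v j i) fun y =>
          if i = sortedPosition h (v j) y then p j * v j y else 0]
        simp only [sortedPosition, Equiv.symm_apply_apply, decreasing, Function.comp_apply]
    _ = _ := (Fintype.sum_prod_type
        fun b : J × Fin n => if i = sortedPosition h (v b.1) b.2 then p b.1 * v b.1 b.2 else 0).symm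

theorem exists_perm_mixture_of_majorized_sum_smul {J : Type*} [Fintype J] {n d : ℕ}
    {u : Fin d → ℝ} {p : J → ℝ} {v : J → Fin n → ℝ}
    (h : Majorized u (∑ j, p j • decreasing (v j))) :
    ∃ t ∈ stdSimplex ℝ (Equiv.Perm (Fin (max d n))), ∀ i, ∑ e, ∑ b : J × Fin n,
      (if e i = sortedPosition (le_max_right d n) (v b.1) b.2 then t e * (p b.1 * v b.1 b.2)
        else 0) = padZeros (max d n) u i := by
  obtain ⟨t, ht, hmix⟩ := exists_perm_mixture_of_majorized h
  refine ⟨t, ht, fun i => ?_⟩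
  rw [← hmix, Finset.sum_apply]
  refine Finset.sum_congr rfl fun e _ => ?_
  rw [Pi.smul_apply, Function.comp_apply, padZeros_sum_smul_decreasing (le_max_right d n),
    smul_eq_mul, Finset.mul_sum]
  simp only [mul_ite, mul_zero]

theorem mem_range_castLE_of_padZeros_ne_zero {n N : ℕ} (h : n ≤ N) {v : Fin n → ℝ} {i : Fin N}
    (hi : padZeros N v i ≠ 0) : i ∈ Set.range (Fin.castLE h) := by
  rw [Fin.range_castLE]
  by_contra hin
  exact hi (dif_neg hin)

theorem mem_range_castLE_of_perm_mixture {B : Type*} [Fintype B] {n N : ℕ} (h : n ≤ N)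
    {v : Fin n → ℝ} {t : Equiv.Perm (Fin N) → ℝ} (ht : 0 ≤ t) {β : B → Fin N} {w : B → ℝ}
    (hw : 0 ≤ w)
    (hmix : ∀ i, ∑ e, ∑ b, (if e i = β b then t e * w b else 0) = padZeros N v i)
    {e : Equiv.Perm (Fin N)} {b : B} (hb : t e * w b ≠ 0) :
    β b ∈ Set.range (e ∘ Fin.castLE h) := by
  let i := e.symm (β b)
  have hnonneg (e' : Equiv.Perm (Fin N)) (b' : B) :
      0 ≤ if e' i = β b' then t e' * w b' else 0 :=
    ite_nonneg (mul_nonneg (ht e') (hw b')) le_rfl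
  have hle : t e * w b ≤ padZeros N v i := calc
    t e * w b = if e i = β b then t e * w b else 0 := by rw [if_pos (e.apply_symm_apply _)]
    _ ≤ ∑ b', if e i = β b' then t e * w b' else 0 :=
      Finset.single_le_sum (fun b' _ => hnonneg e b') (Finset.mem_univ b)
    _ ≤ ∑ e', ∑ b', if e' i = β b' then t e' * w b' else 0 :=
      Finset.single_le_sum
        (f := fun e' : Equiv.Perm (Fin N) => ∑ b', if e' i = β b' then t e' * w b' else 0)
        (fun e' _ => Finset.sum_nonneg fun b' _ => hnonneg e' b') (Finset.mem_univ e)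
    _ = padZeros N v i := hmix i
  have hpos : 0 < t e * w b := (mul_nonneg (ht e) (hw b)).lt_of_ne' hb
  obtain ⟨x, hx⟩ := mem_range_castLE_of_padZeros_ne_zero h (hpos.trans_le hle).ne'
  exact ⟨x, by rw [Function.comp_apply, hx, e.apply_symm_apply]⟩

/- The Kraus operator of a permutation `e` of the mixture and a herald `j` matches the basis vector
`x` with the entry of `φ j` sorted into position `e x`. -/
theorem exists_isDIO_of_majorized {d_in d_out m : ℕ} {ψ : EuclideanSpace ℂ (Fin d_in)}
    (hψ : ψ ≠ 0) {p : Fin m → ℝ} (hp : 0 ≤ p) {φ : Fin m → EuclideanSpace ℂ (Fin d_out)}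
    (h : Majorized (cohDist ψ) (∑ j, p j • decreasing (cohDist (φ j)))) :
    ∃ E : Matrix (Fin d_in) (Fin d_in) ℂ →CP Matrix (Fin m × Fin d_out) (Fin m × Fin d_out) ℂ,
      IsDIO E ∧ E (pureState ψ) = heraldedState p φ := by
  obtain ⟨t, ⟨ht, ht_sum⟩, hmix⟩ := exists_perm_mixture_of_majorized_sum_smul h
  have hin := le_max_left d_in d_out
  have hout := le_max_right d_in d_out
  let β (b : Fin m × Fin d_out) := sortedPosition hout (cohDist (φ b.1)) b.2
  let w (b : Fin m × Fin d_out) := p b.1 * cohDist (φ b.1) b.2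
  have hw : 0 ≤ w := fun b => mul_nonneg (hp _) (sq_nonneg _)
  let f (i : Equiv.Perm (Fin (max d_in d_out)) × Fin m) :=
    branchVector (t i.1 * p i.2) i.2 (φ i.2)
  have hfnorm (i b) : ‖f i b‖ ^ 2 = if b.1 = i.2 then t i.1 * w b else 0 := by
    rw [norm_sq_branchVector (mul_nonneg (ht _) (hp _))]
    split_ifs with hb
    · rw [← hb, mul_assoc]
    · rfl
  have hsupport {i b} (hb : b ∈ Function.support (f i)) : b.1 = i.2 ∧ t i.1 * w b ≠ 0 :=
    ite_ne_right_iff.1 (hfnorm i b ▸ pow_ne_zero 2 (norm_ne_zero_iff.2 hb))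
  have hβ (i) : Set.InjOn β (Function.support (f i)) := by
    rintro ⟨j, y⟩ hy ⟨j', y'⟩ hy' hyy'
    obtain rfl : j = j' := (hsupport hy).1.trans (hsupport hy').1.symm
    exact congrArg (Prod.mk j) (sortedPosition_injective hout _ hyy')
  have hnorm (x) : ∑ i, ∑ b, (if (i.1 ∘ Fin.castLE hin) x = β b then ‖f i b‖ ^ 2 else 0) =
      cohDist ψ x := by
    rw [← padZeros_castLE hin (cohDist ψ) x, ← hmix, Fintype.sum_prod_type]
    refine Finset.sum_congr rfl fun e _ => ?_
    rw [Finset.sum_comm]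
    refine Finset.sum_congr rfl fun b _ => ?_
    simp only [hfnorm, Function.comp_apply]
    split_ifs <;> simp [w]
  obtain ⟨E, hE, hEψ⟩ := exists_isDIO_of_matching hψ
    (fun i => i.1.injective.comp (Fin.castLE_injective hin)) hβ
    (fun i b hb => mem_range_castLE_of_perm_mixture hin ht hw hmix (hsupport hb).2) hnorm
  exact ⟨E, hE, hEψ.trans (sum_vecMulVec_branchVector ht ht_sum hp φ)⟩

theorem mainTheorem6_general {d_in d_out m : ℕ} (ψ : EuclideanSpace ℂ (Fin d_in)) (hψ : ψ ≠ 0)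
    (p : Fin m → ℝ) (hp : ∀ j, 0 ≤ p j) (φ : Fin m → EuclideanSpace ℂ (Fin d_out)) :
    (∃ E : Matrix (Fin d_in) (Fin d_in) ℂ →CP
          Matrix (Fin m × Fin d_out) (Fin m × Fin d_out) ℂ,
        IsDIO E ∧ E (pureState ψ) = heraldedState p φ) ↔
      Majorized (cohDist ψ) (∑ j, p j • decreasing (cohDist (φ j))) :=
  ⟨fun ⟨_, hE, hEψ⟩ => majorized_of_isDIO hp hE hEψ, exists_isDIO_of_majorized hψ hp⟩

theorem mainTheorem6 {d_in d_out m : ℕ}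
    (ψ : EuclideanSpace ℂ (Fin d_in)) (hψ : ‖ψ‖ = 1)
    (p : Fin m → ℝ) (hp : ∀ j, 0 ≤ p j) (hp_sum : ∑ j, p j = 1)
    (φ : Fin m → EuclideanSpace ℂ (Fin d_out)) (hφ : ∀ j, ‖φ j‖ = 1) :
    (∃ E : Matrix (Fin d_in) (Fin d_in) ℂ →CP
          Matrix (Fin m × Fin d_out) (Fin m × Fin d_out) ℂ,
        IsDIO E ∧ E (pureState ψ) = heraldedState p φ) ↔
      Majorized (cohDist ψ) (∑ j, p j • decreasing (cohDist (φ j))) :=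
  mainTheorem6_general ψ (norm_ne_zero_iff.1 (hψ ▸ one_ne_zero)) p hp φ
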